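/- Let $G=(V,E)$ be a finite connected simple graph and let $\gamma:(0,\infty)\to(0,\infty)$ be Lipschitz on $[\delta,1]$ for every $\delta>0$. For positive edge weights $w=(w_e)_{e\in E}$ let $d=d_w$ be the weighted shortest-path distance on $V$, and for $\alpha\in[0,1]$ and $x\in V$ let $\mu_x^\alpha$ be the probability distribution on $V$ with $\mu_x^\alpha(x)=\alpha$, $\mu_x^\alpha(y)=(1-\alpha)\gamma(w_{xy})/\sum_{z\sim x}\gamma(w_{xz})$ for $y\sim x$, and $\mu_x^\alpha(y)=0$ otherwise. Let $W$ be the transportation distance between probability distributions on $V$ with cost $d$ (the infimum of $\sum_{x,y}A(x,y)d(x,y)$ over all couplings $A$), and let the Ollivier–Lin–Lu–Yau curvature of an edge $e=xy$ be $$\kappa_e=\lim_{\alpha\to1^-}\frac{1}{1-\alpha}\Big(1-\frac{W(\mu_x^\alpha,\mu_y^\alpha)}{d(x,y)}\Big).$$ Let $X_0\in\mathbb{R}^E$ have positive entries with sum $1$. A solution of the normalized Ricci flow on an interval $I\ni0$ is a differentiable curve $t\mapsto w(t)=(w_e(t))_{e\in E}$, $t\in I$, with all $w_e(t)>0$, $w(0)=X_0$,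 and $$\frac{dw_e}{dt}=-\kappa_e w_e+w_e\sum_{h\in E}\kappa_h w_h\qquad(e\in E,\ t\in I),$$ where $\kappa_e=\kappa_e(t)$ is the curvature for the weights $w(t)$ (the defining limits exist), and the derivative at $t=0$ is one-sided. Assume that the exit condition "$w_{uv}(t)>d_{w(t)}(u,v)$ for some edge $uv$" is never met: for every $T>0$, every solution on $[0,T)$ and every $t\in[0,T)$, each edge $uv$ satisfies $w_{uv}(t)\le d_{w(t)}(u,v)$, i.e. each edge is a shortest path between its endpoints. Then the normalized Ricci flow has a unique solution on $[0,\infty)$. -/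

import Mathlib

open Filter Topology Set

noncomputable section

namespace RicciFlow

variable {V : Type*} {G : SimpleGraph V}

/-- The length of a walk: the sum of the weights of its edges. -/
def walkLength (w : G.edgeSet → ℝ) : {x y : V} → G.Walk x y → ℝ
  | _, _, .nil => 0
  | _, _, .cons h p => w ⟨s(_, _), h⟩ + walkLength w p

/-- The weighted distance `d(x, y)`. For positive weights on a finite connected graph the infimum
over all walks is the minimum over all paths. -/
def wdist (w : G.edgeSet → ℝ) (x y : V) : ℝ :=
  sInf (Set.range fun p : G.Walk x y => walkLength w p)

open Classical in
/-- `γ (w_xy)` if `x ∼ y`, and `0` otherwise. -/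
def gammaWeight (γ : ℝ → ℝ) (w : G.edgeSet → ℝ) (x y : V) : ℝ :=
  if h : G.Adj x y then γ (w ⟨s(x, y), h⟩) else 0

variable [Fintype V]

open Classical in
/-- The distribution `μ_x^α`: mass `α` at `x`, and mass `(1 - α) γ(w_xy) / ∑_{z ∼ x} γ(w_xz)` at
each neighbour `y` of `x`. -/
def mu (γ : ℝ → ℝ) (w : G.edgeSet → ℝ) (α : ℝ) (x y : V) : ℝ :=
  if y = x then α else (1 - α) * (gammaWeight γ w x y / ∑ z, gammaWeight γ w x z)

/-- `A` is a coupling of the distributions `μ₁` and `μ₂` on the finite set `V` (its entries are then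
automatically at most `1`). -/
structure IsCoupling (μ₁ μ₂ : V → ℝ) (A : V → V → ℝ) : Prop where
  nonneg : ∀ x y, 0 ≤ A x y
  fst : ∀ x, ∑ y, A x y = μ₁ x
  snd : ∀ y, ∑ x, A x y = μ₂ y

/-- The transportation distance with respect to the cost `d`. -/
def transportDist (d : V → V → ℝ) (μ₁ μ₂ : V → ℝ) : ℝ :=
  sInf {c : ℝ | ∃ A : V → V → ℝ, IsCoupling μ₁ μ₂ A ∧ c = ∑ x, ∑ y, A x y * d x y}

/-- The `α`-Ricci curvature `κ_α(x, y) = 1 - W(μ_x^α, μ_y^α) / d(x, y)`. -/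
def alphaCurvature (γ : ℝ → ℝ) (w : G.edgeSet → ℝ) (α : ℝ) (x y : V) : ℝ :=
  1 - transportDist (wdist w) (mu γ w α x) (mu γ w α y) / wdist w x y

/-- `κ` is the Ollivier-Lin-Lu-Yau curvature of the edges: for each edge `xy` the limit
`κ_xy = lim_{α → 1} κ_α(x, y) / (1 - α)`, with `α < 1`, exists and has this value. -/
def IsCurvature (γ : ℝ → ℝ) (w κ : G.edgeSet → ℝ) : Prop :=
  ∀ (x y : V) (h : G.Adj x y),
    Tendsto (fun α : ℝ => alphaCurvature γ w α x y / (1 - α)) (𝓝[<] 1) (𝓝 (κ ⟨s(x, y), h⟩))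

/-- `X` solves the initial value problem of the normalized Ricci flow
`dw_e/dt = -κ_e w_e + w_e ∑_h κ_h w_h`, `w(0) = X₀`, on the interval `I` (which contains `0`), with
positive edge weights. At `t = 0` the derivative is one-sided. -/
structure IsRicciFlowOn [Fintype G.edgeSet] (γ : ℝ → ℝ) (X₀ : G.edgeSet → ℝ) (I : Set ℝ)
    (X : ℝ → G.edgeSet → ℝ) : Prop where
  init : X 0 = X₀
  pos : ∀ t ∈ I, ∀ e, 0 < X t e
  flow : ∃ κ : ℝ → G.edgeSet → ℝ, ∀ t ∈ I, IsCurvature γ (X t) (κ t) ∧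
    ∀ e, HasDerivWithinAt (fun s => X s e)
      (-(κ t e) * X t e + X t e * ∑ h, κ t h * X t h) I t

/-- The exit condition for the weights `w`: some edge is longer than the distance of its ends. -/
def ExitCondition (w : G.edgeSet → ℝ) : Prop :=
  ∃ (x y : V) (h : G.Adj x y), wdist w x y < w ⟨s(x, y), h⟩

end RicciFlow

end

/-! For idleness in `[1/2, 1)` the transportation distance across an edge is affine in the idleness
(`transportDist_mu`), so the defining limit of the curvature always exists and equals `2 κ_{1/2}`.
The flow is therefore an autonomous ODE, whose field is Lipschitz on each box `[δ, 1]^E`: distances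
and distributions vary there by factors `1 - O(r)`, and the transportation distance is stable under
such changes (`transportDist_le_add`).

What remains is to keep the weights in a compact box on bounded time intervals. The total weight
minus `1` solves a linear homogeneous equation, so it stays `0` and every weight is at most `1`.
Always `κ_e ≤ 2`. Without exit `w_e = d(x, y)`, so `κ_e w_e = 2 (d - W)` is bounded below by the
diameter bound (`neg_le_curvature_mul`). Hence `(log w_e)'` is bounded below and weights decay at
most exponentially (`IsRicciFlowOn.exp_le`). Solutions up to time `T` are thus trajectories of one
globally Lipschitz clamped field. This gives uniqueness by Grönwall and, with Picard–Lindelöf and a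
first-exit argument, existence on every `[0, T)`; these solutions glue. -/

namespace RicciFlow

/-! ### Couplings and stability of the transportation distance -/

section Transport

variable {V : Type*} [Fintype V] {μ ν μ' ν' : V → ℝ} {d d' A : V → V → ℝ}

/-- `μ` is a probability distribution on the finite set `V`. -/
structure IsProb (μ : V → ℝ) : Prop where
  nonneg : ∀ x, 0 ≤ μ x
  sum_eq_one : ∑ x, μ x = 1

lemma IsProb.isCoupling_mul (hμ : IsProb μ) (hν : IsProb ν) :
    IsCoupling μ ν (fun x y => μ x * ν y) where
  nonneg x y := mul_nonneg (hμ.nonneg x) (hν.nonneg y)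
  fst x := by rw [← Finset.mul_sum, hν.sum_eq_one, mul_one]
  snd y := by rw [← Finset.sum_mul, hμ.sum_eq_one, one_mul]

lemma IsCoupling.sum_eq_one (hA : IsCoupling μ ν A) (hμ : IsProb μ) :
    ∑ x, ∑ y, A x y = 1 := by
  simp_rw [hA.fst, hμ.sum_eq_one]

lemma IsCoupling.swap (hA : IsCoupling μ ν A) : IsCoupling ν μ (fun x y => A y x) where
  nonneg x y := hA.nonneg y x
  fst := hA.snd
  snd := hA.fst

lemma IsCoupling.cost_nonneg (hd : ∀ x y, 0 ≤ d x y) (hA : IsCoupling μ ν A) :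
    0 ≤ ∑ x, ∑ y, A x y * d x y :=
  Finset.sum_nonneg fun x _ => Finset.sum_nonneg fun y _ => mul_nonneg (hA.nonneg x y) (hd x y)

lemma IsCoupling.cost_le {ε : ℝ} (hd : ∀ x y, d' x y ≤ d x y + ε) (hμ : IsProb μ)
    (hA : IsCoupling μ ν A) :
    ∑ x, ∑ y, A x y * d' x y ≤ ∑ x, ∑ y, A x y * d x y + ε := by
  calc ∑ x, ∑ y, A x y * d' x y ≤ ∑ x, ∑ y, (A x y * d x y + A x y * ε) := by
        gcongr with x _ y _
        nlinarith [hA.nonneg x y, hd x y]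
    _ = _ := by
        simp_rw [Finset.sum_add_distrib, ← Finset.sum_mul, hA.sum_eq_one hμ, one_mul]

lemma transportDist_le (hd : ∀ x y, 0 ≤ d x y) (hA : IsCoupling μ ν A) :
    transportDist d μ ν ≤ ∑ x, ∑ y, A x y * d x y := by
  refine csInf_le ⟨0, ?_⟩ ⟨A, hA, rfl⟩
  rintro _ ⟨B, hB, rfl⟩
  exact hB.cost_nonneg hd

/-- The product coupling is needed for nonemptiness: the real `sInf` of the empty set is `0`. -/
lemma le_transportDist (hμ : IsProb μ) (hν : IsProb ν) {c : ℝ}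
    (h : ∀ A, IsCoupling μ ν A → c ≤ ∑ x, ∑ y, A x y * d x y) : c ≤ transportDist d μ ν := by
  refine le_csInf ⟨_, _, hμ.isCoupling_mul hν, rfl⟩ ?_
  rintro _ ⟨B, hB, rfl⟩
  exact h B hB

lemma transportDist_nonneg (hd : ∀ x y, 0 ≤ d x y) (hμ : IsProb μ) (hν : IsProb ν) :
    0 ≤ transportDist d μ ν :=
  le_transportDist hμ hν fun _ hA => hA.cost_nonneg hd

lemma transportDist_le_of_le {D : ℝ} (hd : ∀ x y, 0 ≤ d x y) (hD : ∀ x y, d x y ≤ D)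
    (hμ : IsProb μ) (hν : IsProb ν) : transportDist d μ ν ≤ D := by
  refine (transportDist_le hd (hμ.isCoupling_mul hν)).trans ?_
  simpa using (hμ.isCoupling_mul hν).cost_le (d' := d) (d := fun _ _ => 0) (ε := D)
    (by simpa using hD) hμ

lemma transportDist_comm (hd : ∀ x y, d x y = d y x) :
    transportDist d μ ν = transportDist d ν μ := by
  have key : ∀ {μ ν : V → ℝ} {c : ℝ},
      (∃ A : V → V → ℝ, IsCoupling μ ν A ∧ c = ∑ x, ∑ y, A x y * d x y) →
        ∃ A : V → V → ℝ, IsCoupling ν μ A ∧ c = ∑ x, ∑ y, A x y * d x y := by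
    rintro μ ν c ⟨A, hA, rfl⟩
    refine ⟨_, hA.swap, ?_⟩
    rw [Finset.sum_comm]
    simp_rw [hd]
  unfold transportDist
  congr 1
  ext c
  exact ⟨key, key⟩

/-- Stability of the transportation distance when the cost changes by at most `ε` and the
distributions keep at least the fraction `1 - t` of each of their masses. -/
lemma transportDist_le_add {D ε t : ℝ} (hd' : ∀ x y, 0 ≤ d' x y)
    (hD : ∀ x y, d' x y ≤ D) (hdd : ∀ x y, d' x y ≤ d x y + ε) (hε : 0 ≤ ε)
    (hd : ∀ x y, 0 ≤ d x y)
    (ht : 0 < t) (ht1 : t ≤ 1) (hμ : IsProb μ) (hν : IsProb ν) (hμ' : IsProb μ')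
    (hν' : IsProb ν') (hμμ : ∀ x, (1 - t) * μ x ≤ μ' x) (hνν : ∀ x, (1 - t) * ν x ≤ ν' x) :
    transportDist d' μ' ν' ≤ transportDist d μ ν + ε + t * D := by
  -- The mass left over from `(1 - t) μ`, rescaled by `1 / t`, is again a probability distribution.
  -- If `A` couples the old distributions and `B` the leftovers, then `(1 - t) A + t B` couples the
  -- new ones, and `B` costs at most `D`.
  have aux : ∀ {μ μ' : V → ℝ}, IsProb μ → IsProb μ' → (∀ x, (1 - t) * μ x ≤ μ' x) →
      IsProb (fun x => (μ' x - (1 - t) * μ x) / t) := by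
    intro μ μ' h h' hle
    refine ⟨fun x => div_nonneg (sub_nonneg.2 (hle x)) ht.le, ?_⟩
    rw [← Finset.sum_div, Finset.sum_sub_distrib, ← Finset.mul_sum, h.sum_eq_one, h'.sum_eq_one]
    field_simp
    ring
  have hB := (aux hμ hμ' hμμ).isCoupling_mul (aux hν hν' hνν)
  set B : V → V → ℝ := fun x y => (μ' x - (1 - t) * μ x) / t * ((ν' y - (1 - t) * ν y) / t)
  rw [add_assoc, ← sub_le_iff_le_add]
  refine le_transportDist hμ hν fun A hA => ?_
  have hC : IsCoupling μ' ν' (fun x y => (1 - t) * A x y + t * B x y) := by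
    refine ⟨fun x y => add_nonneg (mul_nonneg (by linarith) (hA.nonneg x y))
      (mul_nonneg ht.le (hB.nonneg x y)), fun x => ?_, fun y => ?_⟩
    · rw [Finset.sum_add_distrib, ← Finset.mul_sum, ← Finset.mul_sum, hA.fst, hB.fst]
      field_simp
      ring
    · rw [Finset.sum_add_distrib, ← Finset.mul_sum, ← Finset.mul_sum, hA.snd, hB.snd]
      field_simp
      ring
  have h1 := transportDist_le hd' hC
  have h2 := hA.cost_le hdd hμ
  have h3 := hB.cost_le (d' := d') (d := fun _ _ => 0) (ε := D) (by simpa using hD)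
    (aux hμ hμ' hμμ)
  have h4 : ∑ x, ∑ y, ((1 - t) * A x y + t * B x y) * d' x y =
      (1 - t) * ∑ x, ∑ y, A x y * d' x y + t * ∑ x, ∑ y, B x y * d' x y := by
    simp_rw [Finset.mul_sum, ← Finset.sum_add_distrib]
    refine Finset.sum_congr rfl fun x _ => Finset.sum_congr rfl fun y _ => by ring
  have h5 := hA.cost_nonneg hd
  simp only [mul_zero, Finset.sum_const_zero, zero_add] at h3
  have h6 := mul_le_mul_of_nonneg_left h2 (sub_nonneg.2 ht1)
  have h7 := mul_le_mul_of_nonneg_left h3 ht.le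
  nlinarith

end Transport

/-! ### Weighted shortest-path distance -/

section Distance

variable {V : Type*} {G : SimpleGraph V} {w w' : G.edgeSet → ℝ}

lemma walkLength_nonneg (hw : ∀ e, 0 ≤ w e) {x y : V} (p : G.Walk x y) : 0 ≤ walkLength w p := by
  induction p with
  | nil => simp [walkLength]
  | cons h p ih => exact add_nonneg (hw _) ih

lemma walkLength_le {c : ℝ} (h : ∀ e, c * w e ≤ w' e) {x y : V} (p : G.Walk x y) :
    c * walkLength w p ≤ walkLength w' p := by
  induction p with
  | nil => simp [walkLength]
  | cons _ p ih =>
    simp only [walkLength, mul_add]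
    exact add_le_add (h _) ih

lemma walkLength_append (w : G.edgeSet → ℝ) {x y z : V} (p : G.Walk x y) (q : G.Walk y z) :
    walkLength w (p.append q) = walkLength w p + walkLength w q := by
  induction p with
  | nil => simp [walkLength]
  | cons h p ih => simp [walkLength, ih, add_assoc]

lemma walkLength_reverse (w : G.edgeSet → ℝ) {x y : V} (p : G.Walk x y) :
    walkLength w p.reverse = walkLength w p := by
  induction p with
  | nil => rfl
  | cons h p ih =>
    simp [walkLength, walkLength_append, ih, Sym2.eq_swap, add_comm]

lemma wdist_le (hw : ∀ e, 0 ≤ w e) {x y : V} (p : G.Walk x y) : wdist w x y ≤ walkLength w p := by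
  refine csInf_le ⟨0, ?_⟩ ⟨p, rfl⟩
  rintro _ ⟨q, rfl⟩
  exact walkLength_nonneg hw q

lemma wdist_le_weight (hw : ∀ e, 0 ≤ w e) {x y : V} (h : G.Adj x y) :
    wdist w x y ≤ w ⟨s(x, y), h⟩ := by
  simpa [walkLength] using wdist_le hw (.cons h .nil)

lemma le_wdist (hG : G.Connected) {x y : V} {c : ℝ} (h : ∀ p : G.Walk x y, c ≤ walkLength w p) :
    c ≤ wdist w x y := by
  obtain ⟨p⟩ := hG.preconnected x y
  refine le_csInf ⟨_, p, rfl⟩ ?_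
  rintro _ ⟨q, rfl⟩
  exact h q

lemma wdist_nonneg (hG : G.Connected) (hw : ∀ e, 0 ≤ w e) (x y : V) : 0 ≤ wdist w x y :=
  le_wdist hG fun p => walkLength_nonneg hw p

lemma wdist_comm (w : G.edgeSet → ℝ) (x y : V) : wdist w x y = wdist w y x := by
  unfold wdist
  congr 1
  ext c
  constructor <;> rintro ⟨p, rfl⟩ <;> exact ⟨p.reverse, walkLength_reverse w p⟩

lemma mul_wdist_le (hG : G.Connected) {c : ℝ} (hc : 0 ≤ c) (hw : ∀ e, 0 ≤ w e)
    (h : ∀ e, c * w e ≤ w' e) (x y : V) : c * wdist w x y ≤ wdist w' x y :=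
  le_wdist hG fun p => (mul_le_mul_of_nonneg_left (wdist_le hw p) hc).trans (walkLength_le h p)

lemma le_wdist_of_ne (hG : G.Connected) {δ : ℝ} (hδ : 0 ≤ δ) (hw : ∀ e, δ ≤ w e) {x y : V}
    (hxy : x ≠ y) : δ ≤ wdist w x y := by
  refine le_wdist hG fun p => ?_
  cases p with
  | nil => exact absurd rfl hxy
  | cons h p =>
    have := walkLength_nonneg (fun e => hδ.trans (hw e)) p
    simp only [walkLength]
    linarith [hw ⟨s(_, _), h⟩]

lemma wdist_pos [Finite G.edgeSet] (hG : G.Connected) (hw : ∀ e, 0 < w e) {x y : V}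
    (hxy : G.Adj x y) : 0 < wdist w x y := by
  have : Nonempty G.edgeSet := ⟨⟨s(x, y), hxy⟩⟩
  obtain ⟨e, he⟩ := Finite.exists_min w
  exact (hw e).trans_le (le_wdist_of_ne hG (hw e).le he hxy.ne)

/-- A common bound of the distances for all edge weights that are at most `M`. -/
noncomputable def distBound [Fintype V] (G : SimpleGraph V) (M : ℝ) : ℝ :=
  ∑ x, ∑ y, wdist (fun _ : G.edgeSet => M) x y

lemma wdist_le_distBound [Fintype V] (hG : G.Connected) {M : ℝ} (hM : 0 ≤ M) (hw : ∀ e, 0 ≤ w e)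
    (hwM : ∀ e, w e ≤ M) (x y : V) : wdist w x y ≤ distBound G M := by
  have hn := wdist_nonneg (w := fun _ : G.edgeSet => M) hG fun _ => hM
  calc wdist w x y ≤ wdist (fun _ : G.edgeSet => M) x y := by
        simpa using mul_wdist_le hG zero_le_one hw (w' := fun _ => M) (by simpa using hwM) x y
    _ ≤ ∑ y, wdist (fun _ : G.edgeSet => M) x y :=
        Finset.single_le_sum (f := fun y => wdist (fun _ : G.edgeSet => M) x y)
          (fun y _ => hn x y) (Finset.mem_univ y)
    _ ≤ distBound G M :=
        Finset.single_le_sum (f := fun x => ∑ y, wdist (fun _ : G.edgeSet => M) x y)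
          (fun x _ => Finset.sum_nonneg fun y _ => hn x y) (Finset.mem_univ x)

lemma distBound_nonneg [Fintype V] (hG : G.Connected) {M : ℝ} (hM : 0 ≤ M) : 0 ≤ distBound G M :=
  Finset.sum_nonneg fun x _ => Finset.sum_nonneg fun y _ => wdist_nonneg hG (fun _ => hM) x y

end Distance

/-! ### Closed form and bounds of the curvature -/

section Curvature

variable {V : Type*} {G : SimpleGraph V} {γ : ℝ → ℝ} {w : G.edgeSet → ℝ}

lemma gammaWeight_nonneg (hγ : ∀ e, 0 < γ (w e)) (x y : V) : 0 ≤ gammaWeight γ w x y := by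
  unfold gammaWeight
  split_ifs
  exacts [(hγ _).le, le_rfl]

lemma gammaWeight_self (x : V) : gammaWeight γ w x x = 0 := by simp [gammaWeight]

lemma forall_edge {p : G.edgeSet → Prop} (h : ∀ x y (hxy : G.Adj x y), p ⟨s(x, y), hxy⟩)
    (e : G.edgeSet) : p e := by
  obtain ⟨e, he⟩ := e
  induction e with
  | _ x y => exact h x y he

variable [Fintype V]

lemma sum_gammaWeight_pos (hγ : ∀ e, 0 < γ (w e)) {x y : V} (h : G.Adj x y) :
    0 < ∑ z, gammaWeight γ w x z :=
  Finset.sum_pos' (fun z _ => gammaWeight_nonneg hγ x z)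
    ⟨y, Finset.mem_univ y, by simpa [gammaWeight, h] using hγ _⟩

lemma isProb_mu (hγ : ∀ e, 0 < γ (w e)) {α : ℝ} (h0 : 0 ≤ α) (h1 : α ≤ 1) {x y : V}
    (h : G.Adj x y) : IsProb (mu γ w α x) := by
  classical
  have hs := sum_gammaWeight_pos hγ h
  refine ⟨fun z => ?_, ?_⟩
  · unfold mu
    split_ifs
    · exact h0
    · exact mul_nonneg (by linarith) (div_nonneg (gammaWeight_nonneg hγ x z) hs.le)
  · have : ∀ z, mu γ w α x z = (if z = x then α else 0) +
        (1 - α) * (gammaWeight γ w x z / ∑ z, gammaWeight γ w x z) := by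
      intro z
      unfold mu
      split_ifs with hz
      · simp [hz, gammaWeight_self]
      · simp
    simp_rw [this, Finset.sum_add_distrib, ← Finset.mul_sum, ← Finset.sum_div, div_self hs.ne']
    simp

-- The parameter `s = 2 (1 - α)` exhibits `μ^α` as a mixture of `μ^{1/2}` and the Dirac mass at `x`.
open Classical in
lemma mu_one_sub_half (γ : ℝ → ℝ) (w : G.edgeSet → ℝ) (s : ℝ) (x z : V) :
    mu γ w (1 - s / 2) x z = s * mu γ w (1 / 2) x z + (1 - s) * (if z = x then 1 else 0) := by
  unfold mu
  split_ifs <;> ring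

/-- For idleness at least `1 / 2`, the transportation distance between the distributions at adjacent
vertices is affine in the idleness: mass at least `2 α - 1` has to go from `x` to `y`. -/
lemma transportDist_mu (hG : G.Connected) (hw : ∀ e, 0 ≤ w e) (hγ : ∀ e, 0 < γ (w e)) {x y : V}
    (h : G.Adj x y) {s : ℝ} (hs : 0 < s) (hs1 : s ≤ 1) :
    transportDist (wdist w) (mu γ w (1 - s / 2) x) (mu γ w (1 - s / 2) y) =
      s * transportDist (wdist w) (mu γ w (1 / 2) x) (mu γ w (1 / 2) y)
        + (1 - s) * wdist w x y := by
  classical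
  have hd := wdist_nonneg hG hw
  have hx := isProb_mu hγ (α := 1 - s / 2) (by linarith) (by linarith) h
  have hy := isProb_mu hγ (α := 1 - s / 2) (by linarith) (by linarith) h.symm
  have hx' := isProb_mu hγ (α := 1 / 2) (by norm_num) (by norm_num) h
  have hy' := isProb_mu hγ (α := 1 / 2) (by norm_num) (by norm_num) h.symm
  -- `P` couples the Dirac masses at `x` and `y`. Adding `(1 - s) P` to a rescaled coupling gives
  -- one inequality, removing it gives the other.
  set P : V → V → ℝ := fun a b => if a = x then if b = y then 1 else 0 else 0 with hP
  have hP1 : ∀ a, ∑ b, P a b = if a = x then 1 else 0 := by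
    intro a; simp only [hP]; split_ifs <;> simp
  have hP2 : ∀ b, ∑ a, P a b = if b = y then 1 else 0 := by
    intro b; simp [hP]
  have hP3 : ∑ a, ∑ b, P a b * wdist w a b = wdist w x y := by
    simp [hP, ite_mul]
  apply le_antisymm
  · rw [← sub_le_iff_le_add, ← div_le_iff₀' hs]
    refine le_transportDist hx' hy' fun A hA => ?_
    rw [div_le_iff₀' hs, sub_le_iff_le_add]
    have hC : IsCoupling (mu γ w (1 - s / 2) x) (mu γ w (1 - s / 2) y)
        (fun a b => s * A a b + (1 - s) * P a b) := by
      refine ⟨fun a b => add_nonneg (mul_nonneg hs.le (hA.nonneg a b))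
        (mul_nonneg (by linarith) ?_), fun a => ?_, fun b => ?_⟩
      · simp only [hP]; split_ifs <;> norm_num
      · rw [Finset.sum_add_distrib, ← Finset.mul_sum, ← Finset.mul_sum, hA.fst, hP1,
          mu_one_sub_half]
      · rw [Finset.sum_add_distrib, ← Finset.mul_sum, ← Finset.mul_sum, hA.snd, hP2,
          mu_one_sub_half]
    refine (transportDist_le hd hC).trans_eq ?_
    simp_rw [add_mul, Finset.sum_add_distrib, mul_assoc, ← Finset.mul_sum]
    rw [hP3]
  · refine le_transportDist hx hy fun A hA => ?_
    -- Row `x` has mass at least `1 - s / 2`, and the columns other than `y` receive only `s / 2` in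
    -- total.
    have hxy : 1 - s ≤ A x y := by
      have h1 := Finset.add_sum_erase Finset.univ (A x) (Finset.mem_univ y)
      have h2 := Finset.add_sum_erase Finset.univ (mu γ w (1 - s / 2) y) (Finset.mem_univ y)
      rw [hA.fst] at h1
      rw [hy.sum_eq_one] at h2
      have h3 : ∑ b ∈ Finset.univ.erase y, A x b ≤
          ∑ b ∈ Finset.univ.erase y, mu γ w (1 - s / 2) y b := by
        refine Finset.sum_le_sum fun b _ => ?_
        rw [← hA.snd b]
        exact Finset.single_le_sum (f := fun a => A a b) (fun a _ => hA.nonneg a b)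
          (Finset.mem_univ x)
      have h4 : mu γ w (1 - s / 2) y y = 1 - s / 2 := by simp [mu]
      have h5 : mu γ w (1 - s / 2) x x = 1 - s / 2 := by simp [mu]
      linarith
    have hC : IsCoupling (mu γ w (1 / 2) x) (mu γ w (1 / 2) y)
        (fun a b => (A a b - (1 - s) * P a b) / s) := by
      refine ⟨fun a b => div_nonneg ?_ hs.le, fun a => ?_, fun b => ?_⟩
      · simp only [hP]
        split_ifs with h1 h2
        · subst h1 h2; linarith
        · simpa using hA.nonneg a b
        · simpa using hA.nonneg a b
      · rw [← Finset.sum_div, Finset.sum_sub_distrib, ← Finset.mul_sum, hA.fst, hP1,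
          mu_one_sub_half]
        field_simp
        ring
      · rw [← Finset.sum_div, Finset.sum_sub_distrib, ← Finset.mul_sum, hA.snd, hP2,
          mu_one_sub_half]
        field_simp
        ring
    have h1 := mul_le_mul_of_nonneg_left (transportDist_le hd hC) hs.le
    have h2 : s * ∑ a, ∑ b, (A a b - (1 - s) * P a b) / s * wdist w a b =
        ∑ a, ∑ b, A a b * wdist w a b - (1 - s) * wdist w x y := by
      rw [← hP3]
      simp_rw [Finset.mul_sum, ← Finset.sum_sub_distrib]
      refine Finset.sum_congr rfl fun a _ => Finset.sum_congr rfl fun b _ => ?_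
      field_simp
    linarith

/-- The closed form `2 κ_{1/2}` of the curvature of a pair of adjacent vertices. -/
noncomputable def pairCurvature (γ : ℝ → ℝ) (w : G.edgeSet → ℝ) (x y : V) : ℝ :=
  2 * (1 - transportDist (wdist w) (mu γ w (1 / 2) x) (mu γ w (1 / 2) y) / wdist w x y)

lemma pairCurvature_comm (γ : ℝ → ℝ) (w : G.edgeSet → ℝ) (x y : V) :
    pairCurvature γ w x y = pairCurvature γ w y x := by
  rw [pairCurvature, transportDist_comm (wdist_comm w), wdist_comm w x y, pairCurvature]

/-- The curvature of an edge, in closed form. -/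
noncomputable def curvature (γ : ℝ → ℝ) (w : G.edgeSet → ℝ) (e : G.edgeSet) : ℝ :=
  Sym2.lift ⟨pairCurvature γ w, pairCurvature_comm γ w⟩ e.1

lemma curvature_mk (γ : ℝ → ℝ) (w : G.edgeSet → ℝ) {x y : V} (h : G.Adj x y) :
    curvature γ w ⟨s(x, y), h⟩ = pairCurvature γ w x y := rfl

variable [Finite G.edgeSet]

/-- By `transportDist_mu` the quotient is constant for `α` in `(1/2, 1)`. -/
lemma tendsto_pairCurvature (hG : G.Connected) (hw : ∀ e, 0 < w e) (hγ : ∀ e, 0 < γ (w e))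
    {x y : V} (h : G.Adj x y) :
    Tendsto (fun α : ℝ => alphaCurvature γ w α x y / (1 - α)) (𝓝[<] 1)
      (𝓝 (pairCurvature γ w x y)) := by
  refine (tendsto_const_nhds (x := pairCurvature γ w x y)).congr' ?_
  have : Ioo (1 / 2 : ℝ) 1 ∈ 𝓝[<] (1 : ℝ) := Ioo_mem_nhdsLT (by norm_num)
  filter_upwards [this] with α hα
  have hd := (wdist_pos hG hw h).ne'
  have h1 : 1 - α ≠ 0 := by linarith [hα.2]
  have := transportDist_mu hG (fun e => (hw e).le) hγ h (s := 2 * (1 - α)) (by linarith [hα.2])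
    (by linarith [hα.1])
  rw [show 1 - 2 * (1 - α) / 2 = α by ring] at this
  rw [pairCurvature, alphaCurvature, this]
  field_simp
  ring

lemma isCurvature_iff (hG : G.Connected) (hw : ∀ e, 0 < w e) (hγ : ∀ e, 0 < γ (w e))
    {κ : G.edgeSet → ℝ} : IsCurvature γ w κ ↔ κ = curvature γ w := by
  constructor
  · intro h
    funext e
    revert e
    exact forall_edge fun x y hxy =>
      tendsto_nhds_unique (h x y hxy) (tendsto_pairCurvature hG hw hγ hxy)
  · rintro rfl x y h
    exact tendsto_pairCurvature hG hw hγ h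

lemma curvature_le_two (hG : G.Connected) (hw : ∀ e, 0 < w e) (hγ : ∀ e, 0 < γ (w e))
    (e : G.edgeSet) : curvature γ w e ≤ 2 := by
  refine forall_edge (p := fun e => curvature γ w e ≤ 2) (fun x y h => ?_) e
  rw [curvature_mk, pairCurvature]
  have := div_nonneg (transportDist_nonneg (wdist_nonneg hG fun e => (hw e).le)
    (isProb_mu hγ (α := 1 / 2) (by norm_num) (by norm_num) h)
    (isProb_mu hγ (α := 1 / 2) (by norm_num) (by norm_num) h.symm)) (wdist_pos hG hw h).le
  linarith

/-- This is where the absence of exit enters: `w e` equals the distance and cancels the denominator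
of the curvature, leaving `2 (d - W)`. -/
lemma neg_le_curvature_mul (hG : G.Connected) (hw : ∀ e, 0 < w e) (hγ : ∀ e, 0 < γ (w e))
    {M : ℝ} (hM : 0 ≤ M) (hwM : ∀ e, w e ≤ M) (hexit : ¬ ExitCondition w) (e : G.edgeSet) :
    -(2 * distBound G M) ≤ curvature γ w e * w e := by
  refine forall_edge (p := fun e => -(2 * distBound G M) ≤ curvature γ w e * w e)
    (fun x y h => ?_) e
  have hw' := fun e => (hw e).le
  have hd : w ⟨s(x, y), h⟩ = wdist w x y := by
    refine le_antisymm (not_lt.1 fun hlt => hexit ⟨x, y, h, hlt⟩) (wdist_le_weight hw' h)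
  have hpos := wdist_pos hG hw h
  rw [curvature_mk, pairCurvature, hd]
  have := transportDist_le_of_le (wdist_nonneg hG hw') (wdist_le_distBound hG hM hw' hwM)
    (isProb_mu hγ (α := 1 / 2) (by norm_num) (by norm_num) h)
    (isProb_mu hγ (α := 1 / 2) (by norm_num) (by norm_num) h.symm)
  have h2 : 2 * (1 - transportDist (wdist w) (mu γ w (1 / 2) x) (mu γ w (1 / 2) y) / wdist w x y)
      * wdist w x y = 2 * wdist w x y
        - 2 * transportDist (wdist w) (mu γ w (1 / 2) x) (mu γ w (1 / 2) y) := by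
    field_simp
  linarith

end Curvature

/-! ### Calculus of bounded Lipschitz and multiplicatively Lipschitz functions -/

section BoundedLipschitz

variable {E : Type*} [PseudoMetricSpace E] {B : Set E} {f g : E → ℝ}

/-- `f` is bounded and Lipschitz on `B`. -/
def IsBddLip (B : Set E) (f : E → ℝ) : Prop :=
  (∃ K, 0 ≤ K ∧ ∀ w ∈ B, ∀ w' ∈ B, |f w - f w'| ≤ K * dist w w') ∧ ∃ M, 0 ≤ M ∧ ∀ w ∈ B, |f w| ≤ M

/-- `f` is multiplicatively Lipschitz on `B`: moving by a small distance `r` decreases it at most by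
a factor `1 - C r`. -/
def IsMulLip (B : Set E) (f : E → ℝ) : Prop :=
  ∃ C, 0 ≤ C ∧ ∀ w ∈ B, ∀ w' ∈ B, (1 - C * dist w w') * f w ≤ f w'

lemma isBddLip_const (c : ℝ) : IsBddLip B fun _ => c :=
  ⟨⟨0, le_rfl, by simp⟩, ⟨|c|, abs_nonneg c, by simp⟩⟩

lemma IsBddLip.add (hf : IsBddLip B f) (hg : IsBddLip B g) : IsBddLip B fun w => f w + g w := by
  obtain ⟨⟨K, hK, hfK⟩, M, hM, hfM⟩ := hf
  obtain ⟨⟨K', hK', hgK⟩, M', hM', hgM⟩ := hg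
  refine ⟨⟨K + K', by positivity, fun w hw w' hw' => ?_⟩, M + M', by positivity, fun w hw => ?_⟩
  · rw [add_sub_add_comm, add_mul]
    exact (abs_add_le _ _).trans (add_le_add (hfK w hw w' hw') (hgK w hw w' hw'))
  · exact (abs_add_le _ _).trans (add_le_add (hfM w hw) (hgM w hw))

lemma IsBddLip.mul (hf : IsBddLip B f) (hg : IsBddLip B g) : IsBddLip B fun w => f w * g w := by
  obtain ⟨⟨K, hK, hfK⟩, M, hM, hfM⟩ := hf
  obtain ⟨⟨K', hK', hgK⟩, M', hM', hgM⟩ := hg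
  refine ⟨⟨M * K' + K * M', by positivity, fun w hw w' hw' => ?_⟩, M * M', by positivity,
    fun w hw => ?_⟩
  · calc |f w * g w - f w' * g w'| = |f w * (g w - g w') + (f w - f w') * g w'| := by ring_nf
      _ ≤ |f w| * |g w - g w'| + |f w - f w'| * |g w'| := by
        rw [← abs_mul, ← abs_mul]; exact abs_add_le _ _
      _ ≤ M * (K' * dist w w') + (K * dist w w') * M' := by
        gcongr
        exacts [hfM w hw, hgK w hw w' hw', hfK w hw w' hw', hgM w' hw']
      _ = _ := by ring
  · rw [abs_mul]
    gcongr
    exacts [hfM w hw, hgM w hw]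

lemma IsBddLip.neg (hf : IsBddLip B f) : IsBddLip B fun w => -f w := by
  simpa using (isBddLip_const (B := B) (-1)).mul hf

lemma IsBddLip.sum {ι : Type*} {s : Finset ι} {f : ι → E → ℝ} (h : ∀ i ∈ s, IsBddLip B (f i)) :
    IsBddLip B fun w => ∑ i ∈ s, f i w := by
  classical
  induction s using Finset.induction_on with
  | empty => simpa using isBddLip_const 0
  | insert a s ha ih =>
    simp only [Finset.sum_insert ha]
    exact (h a (by simp)).add (ih fun i hi => h i (by simp [hi]))

lemma IsBddLip.inv {c : ℝ} (hf : IsBddLip B f) (hc : 0 < c) (hfc : ∀ w ∈ B, c ≤ f w) :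
    IsBddLip B fun w => (f w)⁻¹ := by
  obtain ⟨⟨K, hK, hfK⟩, -⟩ := hf
  refine ⟨⟨K / c ^ 2, by positivity, fun w hw w' hw' => ?_⟩, c⁻¹, by positivity, fun w hw => ?_⟩
  · have h1 := hc.trans_le (hfc w hw)
    have h2 := hc.trans_le (hfc w' hw')
    rw [inv_sub_inv h1.ne' h2.ne', abs_div, abs_of_pos (mul_pos h1 h2), abs_sub_comm,
      div_mul_eq_mul_div]
    gcongr
    · exact hfK w hw w' hw'
    · rw [pow_two]
      exact mul_le_mul (hfc w hw) (hfc w' hw') hc.le h1.le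
  · have h1 := hfc w hw
    rw [abs_of_pos (inv_pos.2 (hc.trans_le h1))]
    exact inv_anti₀ hc h1

lemma IsMulLip.isBddLip (hf : IsMulLip B f) (hf0 : ∀ w ∈ B, 0 ≤ f w) {M : ℝ} (hM : 0 ≤ M)
    (hfM : ∀ w ∈ B, f w ≤ M) : IsBddLip B f := by
  obtain ⟨C, hC, h⟩ := hf
  refine ⟨⟨C * M, by positivity, fun w hw w' hw' => ?_⟩, M, hM, fun w hw => ?_⟩
  · have key : ∀ w ∈ B, ∀ w' ∈ B, f w - f w' ≤ C * M * dist w w' := by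
      intro w hw w' hw'
      have h1 := h w hw w' hw'
      have h2 := mul_le_mul_of_nonneg_left (hfM w hw) (mul_nonneg hC (dist_nonneg (x := w) (y := w')))
      nlinarith
    rw [abs_sub_le_iff]
    refine ⟨key w hw w' hw', ?_⟩
    rw [dist_comm]
    exact key w' hw' w hw
  · rw [abs_of_nonneg (hf0 w hw)]
    exact hfM w hw

lemma isMulLip_const (c : ℝ) : IsMulLip B fun _ => c := ⟨0, le_rfl, by simp⟩

lemma IsMulLip.sum {ι : Type*} {s : Finset ι} {f : ι → E → ℝ} (h : ∀ i ∈ s, IsMulLip B (f i))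
    (h0 : ∀ i ∈ s, ∀ w ∈ B, 0 ≤ f i w) : IsMulLip B fun w => ∑ i ∈ s, f i w := by
  choose! C hC hf using h
  refine ⟨∑ i ∈ s, C i, Finset.sum_nonneg hC, fun w hw w' hw' => ?_⟩
  rw [Finset.mul_sum]
  refine Finset.sum_le_sum fun i hi => le_trans ?_ (hf i hi w hw w' hw')
  have := Finset.single_le_sum hC hi
  have := h0 i hi w hw
  gcongr

/-- The factors combine by `(1 - C r) (1 - C' r) ≥ 1 - (C + C') r`; when the right side is not
positive there is nothing to prove. -/
lemma IsMulLip.div (hf : IsMulLip B f) (hg : IsMulLip B g) (hf0 : ∀ w ∈ B, 0 ≤ f w)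
    (hg0 : ∀ w ∈ B, 0 < g w) : IsMulLip B fun w => f w / g w := by
  obtain ⟨C, hC, hfC⟩ := hf
  obtain ⟨C', hC', hgC⟩ := hg
  refine ⟨C + C', by positivity, fun w hw w' hw' => ?_⟩
  have hr := dist_nonneg (x := w) (y := w')
  have h1 := hfC w hw w' hw'
  have h2 := hgC w' hw' w hw
  rw [dist_comm] at h2
  have hg1 := hg0 w hw
  have hg2 := hg0 w' hw'
  have hf1 := hf0 w hw
  have hf2 := hf0 w' hw'
  set r := dist w w'
  rcases le_total 1 ((C + C') * r) with h | h
  · exact (mul_nonpos_of_nonpos_of_nonneg (by linarith) (by positivity)).trans (by positivity)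
  · have hCr : 0 ≤ C * r := by positivity
    have hCr' : 0 ≤ C' * r := by positivity
    rw [← mul_div_assoc, div_le_div_iff₀ hg1 hg2]
    calc (1 - (C + C') * r) * f w * g w' ≤ ((1 - C * r) * (1 - C' * r)) * f w * g w' := by
          gcongr
          nlinarith
      _ = ((1 - C * r) * f w) * ((1 - C' * r) * g w') := by ring
      _ ≤ f w' * g w := mul_le_mul h1 h2 (mul_nonneg (by nlinarith) hg2.le) hf2

lemma IsMulLip.const_mul (hf : IsMulLip B f) {c : ℝ} (hc : 0 ≤ c) : IsMulLip B fun w => c * f w := by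
  obtain ⟨C, hC, h⟩ := hf
  refine ⟨C, hC, fun w hw w' hw' => ?_⟩
  have := mul_le_mul_of_nonneg_left (h w hw w' hw') hc
  linarith

end BoundedLipschitz

/-! ### Retraction onto a box of weights -/

section Clamp

variable {V : Type*} {G : SimpleGraph V} {δ M : ℝ}

/-- The edge weights with all entries in `[δ, M]`. -/
def weightBox (G : SimpleGraph V) (δ M : ℝ) : Set (G.edgeSet → ℝ) := {w | ∀ e, w e ∈ Icc δ M}

/-- The nearest edge weights with all entries in `[δ, M]`. -/
def clampWeight (δ M : ℝ) (w : G.edgeSet → ℝ) : G.edgeSet → ℝ := fun e => max δ (min (w e) M)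

lemma clampWeight_mem (hδM : δ ≤ M) (w : G.edgeSet → ℝ) : clampWeight δ M w ∈ weightBox G δ M :=
  fun _ => ⟨le_max_left _ _, max_le hδM (min_le_right _ _)⟩

lemma clampWeight_of_mem {w : G.edgeSet → ℝ} (hw : w ∈ weightBox G δ M) :
    clampWeight δ M w = w := by
  funext e
  simp [clampWeight, (hw e).1, (hw e).2]

lemma dist_clampWeight_le [Fintype G.edgeSet] (w w' : G.edgeSet → ℝ) :
    dist (clampWeight δ M w) (clampWeight δ M w') ≤ dist w w' := by
  refine (dist_pi_le_iff dist_nonneg).2 fun e => le_trans ?_ (dist_le_pi_dist w w' e)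
  simp only [clampWeight, Real.dist_eq]
  rw [max_comm, max_comm δ]
  exact (abs_sup_sub_sup_le_abs _ _ _).trans (abs_inf_sub_inf_le_abs _ _ _)

end Clamp

/-! ### Lipschitz bounds for the flow field on a box -/

section Box

variable {V : Type*} {G : SimpleGraph V} [Fintype G.edgeSet] {γ : ℝ → ℝ} {δ M : ℝ}

/-- By compactness `γ` has a positive minimum on `[δ, M]`; dividing `K` by it turns the additive
bound into a multiplicative one. -/
lemma isMulLip_comp_eval (hδM : δ ≤ M) {K : NNReal} (hγ : LipschitzOnWith K γ (Icc δ M))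
    (hγ_pos : ∀ x ∈ Icc δ M, 0 < γ x) (e : G.edgeSet) :
    IsMulLip (weightBox G δ M) fun w => γ (w e) := by
  obtain ⟨x, hx, hmin⟩ := isCompact_Icc.exists_isMinOn (nonempty_Icc.2 hδM) hγ.continuousOn
  have hc := hγ_pos x hx
  refine ⟨K / γ x, by positivity, fun w hw w' hw' => ?_⟩
  have h1 := (le_abs_self _).trans (hγ.dist_le_mul _ (hw e) _ (hw' e))
  have h2 : K * dist (w e) (w' e) ≤ K * dist w w' := by
    gcongr
    exact dist_le_pi_dist w w' e
  have h3 : K * dist w w' ≤ K / γ x * dist w w' * γ (w e) := by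
    have h4 : γ x ≤ γ (w e) := hmin (hw e)
    calc K * dist w w' = K / γ x * dist w w' * γ x := by field_simp
      _ ≤ _ := by gcongr
  linarith

lemma isMulLip_gammaWeight (hδM : δ ≤ M) {K : NNReal} (hγ : LipschitzOnWith K γ (Icc δ M))
    (hγ_pos : ∀ x ∈ Icc δ M, 0 < γ x) (x y : V) :
    IsMulLip (weightBox G δ M) fun w => gammaWeight γ w x y := by
  by_cases h : G.Adj x y
  · simpa [gammaWeight, h] using isMulLip_comp_eval hδM hγ hγ_pos ⟨s(x, y), h⟩
  · simpa [gammaWeight, h] using isMulLip_const 0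

lemma mul_le_of_mem_weightBox (hδ : 0 < δ) {w w' : G.edgeSet → ℝ} (hw : w ∈ weightBox G δ M)
    (e : G.edgeSet) : (1 - δ⁻¹ * dist w w') * w e ≤ w' e := by
  have h1 := (le_abs_self _).trans (dist_le_pi_dist w w' e)
  have h2 : dist w w' = δ⁻¹ * dist w w' * δ := by field_simp
  have h3 : δ⁻¹ * dist w w' * δ ≤ δ⁻¹ * dist w w' * w e := by
    gcongr
    exact (hw e).1
  linarith

lemma mul_wdist_le_of_mem_weightBox (hG : G.Connected) (hδ : 0 < δ) {w w' : G.edgeSet → ℝ}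
    (hw : w ∈ weightBox G δ M) (hw' : w' ∈ weightBox G δ M) (x y : V) :
    (1 - δ⁻¹ * dist w w') * wdist w x y ≤ wdist w' x y := by
  have hn := wdist_nonneg hG (fun e => hδ.le.trans (hw e).1) x y
  have hn' := wdist_nonneg hG (fun e => hδ.le.trans (hw' e).1) x y
  rcases le_total 0 (1 - δ⁻¹ * dist w w') with h | h
  · exact mul_wdist_le hG h (fun e => hδ.le.trans (hw e).1) (mul_le_of_mem_weightBox hδ hw) x y
  · exact (mul_nonpos_of_nonpos_of_nonneg h hn).trans hn'

lemma isBddLip_eval (hδ : 0 ≤ δ) (hM : 0 ≤ M) (e : G.edgeSet) :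
    IsBddLip (weightBox G δ M) fun w => w e := by
  refine ⟨⟨1, zero_le_one, fun w _ w' _ => ?_⟩, M, hM, fun w hw => ?_⟩
  · simpa [Real.dist_eq] using dist_le_pi_dist w w' e
  · rw [abs_of_nonneg (hδ.trans (hw e).1)]
    exact (hw e).2

variable [Fintype V]

lemma isBddLip_wdist (hG : G.Connected) (hδ : 0 < δ) (hM : 0 ≤ M) (x y : V) :
    IsBddLip (weightBox G δ M) fun w => wdist w x y :=
  IsMulLip.isBddLip ⟨δ⁻¹, by positivity, fun _ hw _ hw' =>
      mul_wdist_le_of_mem_weightBox hG hδ hw hw' x y⟩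
    (fun _ hw => wdist_nonneg hG (fun e => hδ.le.trans (hw e).1) x y) (distBound_nonneg hG hM)
    fun _ hw => wdist_le_distBound hG hM (fun e => hδ.le.trans (hw e).1) (fun e => (hw e).2) x y

lemma isMulLip_mu (hδM : δ ≤ M) {K : NNReal} (hγ : LipschitzOnWith K γ (Icc δ M))
    (hγ_pos : ∀ x ∈ Icc δ M, 0 < γ x) {x y : V} (h : G.Adj x y) (z : V) :
    IsMulLip (weightBox G δ M) fun w => mu γ w (1 / 2) x z := by
  have hpos : ∀ w ∈ weightBox G δ M, ∀ e, 0 < γ (w e) := fun w hw e => hγ_pos _ (hw e)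
  unfold mu
  split_ifs
  · exact isMulLip_const _
  · refine IsMulLip.const_mul (IsMulLip.div (isMulLip_gammaWeight hδM hγ hγ_pos x z)
      (IsMulLip.sum (fun z _ => isMulLip_gammaWeight hδM hγ hγ_pos x z) ?_) ?_ ?_) (by norm_num)
    · exact fun z _ w hw => gammaWeight_nonneg (hpos w hw) x z
    · exact fun w hw => gammaWeight_nonneg (hpos w hw) x z
    · exact fun w hw => sum_gammaWeight_pos (hpos w hw) h

/-- `transportDist_le_add` needs one fraction for all vertices, so the constants are summed over
`z`. -/
lemma exists_mul_mu_le (hδM : δ ≤ M) {K : NNReal} (hγ : LipschitzOnWith K γ (Icc δ M))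
    (hγ_pos : ∀ x ∈ Icc δ M, 0 < γ x) {x y : V} (h : G.Adj x y) :
    ∃ C, 0 ≤ C ∧ ∀ w ∈ weightBox G δ M, ∀ w' ∈ weightBox G δ M, ∀ z,
      (1 - C * dist w w') * mu γ w (1 / 2) x z ≤ mu γ w' (1 / 2) x z := by
  choose C hC hmu using isMulLip_mu hδM hγ hγ_pos h
  refine ⟨∑ z, C z, Finset.sum_nonneg fun z _ => hC z, fun w hw w' hw' z =>
    le_trans ?_ (hmu z w hw w' hw')⟩
  have := (isProb_mu (α := 1 / 2) (fun e => hγ_pos _ (hw e)) (by norm_num) (by norm_num) h).nonneg z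
  have := Finset.single_le_sum (fun z _ => hC z) (Finset.mem_univ z)
  gcongr

lemma isBddLip_transportDist (hG : G.Connected) (hδ : 0 < δ) (hδM : δ ≤ M) {K : NNReal}
    (hγ : LipschitzOnWith K γ (Icc δ M)) (hγ_pos : ∀ x ∈ Icc δ M, 0 < γ x) {x y : V}
    (h : G.Adj x y) :
    IsBddLip (weightBox G δ M) fun w =>
      transportDist (wdist w) (mu γ w (1 / 2) x) (mu γ w (1 / 2) y) := by
  have hM : 0 ≤ M := hδ.le.trans hδM
  have hD := distBound_nonneg hG hM
  have hw0 : ∀ w ∈ weightBox G δ M, ∀ e, 0 ≤ w e := fun w hw e => hδ.le.trans (hw e).1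
  have hwD : ∀ w ∈ weightBox G δ M, ∀ x y, wdist w x y ≤ distBound G M := fun w hw =>
    wdist_le_distBound hG hM (hw0 w hw) fun e => (hw e).2
  have hpx : ∀ w ∈ weightBox G δ M, IsProb (mu γ w (1 / 2) x) := fun w hw =>
    isProb_mu (fun e => hγ_pos _ (hw e)) (by norm_num) (by norm_num) h
  have hpy : ∀ w ∈ weightBox G δ M, IsProb (mu γ w (1 / 2) y) := fun w hw =>
    isProb_mu (fun e => hγ_pos _ (hw e)) (by norm_num) (by norm_num) h.symm
  have hW0 : ∀ w ∈ weightBox G δ M,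
      0 ≤ transportDist (wdist w) (mu γ w (1 / 2) x) (mu γ w (1 / 2) y) := fun w hw =>
    transportDist_nonneg (wdist_nonneg hG (hw0 w hw)) (hpx w hw) (hpy w hw)
  have hWD : ∀ w ∈ weightBox G δ M,
      transportDist (wdist w) (mu γ w (1 / 2) x) (mu γ w (1 / 2) y) ≤ distBound G M := fun w hw =>
    transportDist_le_of_le (wdist_nonneg hG (hw0 w hw)) (hwD w hw) (hpx w hw) (hpy w hw)
  obtain ⟨C, hC, hmx⟩ := exists_mul_mu_le hδM hγ hγ_pos h
  obtain ⟨C', hC', hmy⟩ := exists_mul_mu_le hδM hγ hγ_pos h.symm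
  set D := distBound G M
  have key : ∀ w ∈ weightBox G δ M, ∀ w' ∈ weightBox G δ M,
      transportDist (wdist w') (mu γ w' (1 / 2) x) (mu γ w' (1 / 2) y)
        - transportDist (wdist w) (mu γ w (1 / 2) x) (mu γ w (1 / 2) y)
      ≤ (δ⁻¹ * D + (C + C' + 1) * D) * dist w w' := by
    intro w hw w' hw'
    have hr := dist_nonneg (x := w) (y := w')
    rcases hr.eq_or_lt with hr0 | hr0
    · rw [dist_eq_zero.1 hr0.symm]
      simp
    have hε : 0 ≤ δ⁻¹ * D * dist w w' := by positivity
    -- The fraction `t = (C + C' + 1) r` serves both distributions, and the `+ 1` keeps it positive.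
    -- If `t ≥ 1`, the difference is at most `D ≤ t D`.
    rcases le_total ((C + C' + 1) * dist w w') 1 with ht | ht
    · have := transportDist_le_add (d := wdist w) (d' := wdist w') (D := D)
        (ε := δ⁻¹ * D * dist w w') (t := (C + C' + 1) * dist w w')
        (wdist_nonneg hG (hw0 w' hw')) (hwD w' hw') ?_ hε (wdist_nonneg hG (hw0 w hw))
        (by positivity) ht
        (hpx w hw) (hpy w hw) (hpx w' hw') (hpy w' hw') ?_ ?_
      · linarith
      · intro a b
        have h1 := mul_wdist_le_of_mem_weightBox hG hδ hw' hw a b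
        rw [dist_comm] at h1
        have h2 : δ⁻¹ * dist w w' * wdist w' a b ≤ δ⁻¹ * dist w w' * D := by
          gcongr
          exact hwD w' hw' a b
        linarith
      · intro a
        refine le_trans ?_ (hmx w hw w' hw' a)
        have := (hpx w hw).nonneg a
        gcongr
        linarith
      · intro a
        refine le_trans ?_ (hmy w hw w' hw' a)
        have := (hpy w hw).nonneg a
        gcongr
        linarith
    · have h1 := hWD w' hw'
      have h2 := hW0 w hw
      have h3 := mul_le_mul_of_nonneg_right ht hD
      linarith
  refine ⟨⟨_, by positivity, fun w hw w' hw' => abs_sub_le_iff.2 ⟨?_, key w hw w' hw'⟩⟩, D, hD,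
    fun w hw => ?_⟩
  · rw [dist_comm]
    exact key w' hw' w hw
  · rw [abs_of_nonneg (hW0 w hw)]
    exact hWD w hw

lemma isBddLip_curvature (hG : G.Connected) (hδ : 0 < δ) (hδM : δ ≤ M) {K : NNReal}
    (hγ : LipschitzOnWith K γ (Icc δ M)) (hγ_pos : ∀ x ∈ Icc δ M, 0 < γ x) (e : G.edgeSet) :
    IsBddLip (weightBox G δ M) fun w => curvature γ w e := by
  refine forall_edge (p := fun e => IsBddLip (weightBox G δ M) fun w => curvature γ w e)
    (fun x y h => ?_) e
  simp only [curvature_mk, pairCurvature, div_eq_mul_inv, sub_eq_add_neg]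
  exact (isBddLip_const 2).mul ((isBddLip_const 1).add
    ((isBddLip_transportDist hG hδ hδM hγ hγ_pos h).mul
      ((isBddLip_wdist hG hδ (hδ.le.trans hδM) x y).inv hδ fun w hw =>
        le_wdist_of_ne hG hδ.le (fun e => (hw e).1) h.ne)).neg)

/-- The right-hand side of the normalized Ricci flow. -/
noncomputable def flowField (γ : ℝ → ℝ) (w : G.edgeSet → ℝ) (e : G.edgeSet) : ℝ :=
  -(curvature γ w e) * w e + w e * ∑ h, curvature γ w h * w h

lemma isBddLip_sum_curvature_mul (hG : G.Connected) (hδ : 0 < δ) (hδM : δ ≤ M) {K : NNReal}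
    (hγ : LipschitzOnWith K γ (Icc δ M)) (hγ_pos : ∀ x ∈ Icc δ M, 0 < γ x) :
    IsBddLip (weightBox G δ M) fun w => ∑ h, curvature γ w h * w h :=
  IsBddLip.sum fun h _ => (isBddLip_curvature hG hδ hδM hγ hγ_pos h).mul
    (isBddLip_eval hδ.le (hδ.le.trans hδM) h)

lemma isBddLip_flowField (hG : G.Connected) (hδ : 0 < δ) (hδM : δ ≤ M) {K : NNReal}
    (hγ : LipschitzOnWith K γ (Icc δ M)) (hγ_pos : ∀ x ∈ Icc δ M, 0 < γ x) (e : G.edgeSet) :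
    IsBddLip (weightBox G δ M) fun w => flowField γ w e :=
  have he := isBddLip_eval (G := G) hδ.le (hδ.le.trans hδM) e
  ((isBddLip_curvature hG hδ hδM hγ hγ_pos e).neg.mul he).add
    (he.mul (isBddLip_sum_curvature_mul hG hδ hδM hγ hγ_pos))

lemma exists_flowField_clampWeight_lipschitz (hG : G.Connected) (hδ : 0 < δ) (hδM : δ ≤ M)
    {K : NNReal} (hγ : LipschitzOnWith K γ (Icc δ M)) (hγ_pos : ∀ x ∈ Icc δ M, 0 < γ x) :
    (∃ C, LipschitzWith C fun w : G.edgeSet → ℝ => flowField γ (clampWeight δ M w)) ∧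
      ∃ L : NNReal, ∀ w : G.edgeSet → ℝ, ‖flowField γ (clampWeight δ M w)‖ ≤ L := by
  choose hK hB using isBddLip_flowField (G := G) hG hδ hδM hγ hγ_pos
  choose C hC hlip using hK
  choose L hL hbd using hB
  have hmem := clampWeight_mem (G := G) hδM
  constructor
  · refine ⟨⟨∑ e, C e, Finset.sum_nonneg fun e _ => hC e⟩,
      LipschitzWith.of_dist_le_mul fun w w' => ?_⟩
    refine (dist_pi_le_iff (mul_nonneg (NNReal.coe_nonneg _) dist_nonneg)).2 fun e => ?_
    refine (hlip e _ (hmem w) _ (hmem w')).trans ?_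
    have := Finset.single_le_sum (fun z _ => hC z) (Finset.mem_univ e)
    refine mul_le_mul this (dist_clampWeight_le w w') dist_nonneg ?_
    exact Finset.sum_nonneg fun e _ => hC e
  · refine ⟨⟨∑ e, L e, Finset.sum_nonneg fun e _ => hL e⟩, fun w => ?_⟩
    refine (pi_norm_le_iff_of_nonneg (NNReal.coe_nonneg _)).2 fun e => ?_
    exact (hbd e _ (hmem w)).trans (Finset.single_le_sum (fun z _ => hL z) (Finset.mem_univ e))

end Box

/-! ### The flow as an ODE and its a priori bounds -/

section Flow

variable {V : Type*} [Fintype V] {G : SimpleGraph V} [Fintype G.edgeSet] {γ γ' : ℝ → ℝ}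
  {X₀ : G.edgeSet → ℝ} {X Y : ℝ → G.edgeSet → ℝ} {I J : Set ℝ} {δ T : ℝ}

omit [Fintype G.edgeSet] in
lemma curvature_congr {w : G.edgeSet → ℝ} (h : ∀ e, γ (w e) = γ' (w e)) :
    curvature γ w = curvature γ' w := by
  have h1 : gammaWeight γ w = gammaWeight γ' w := by
    funext x y
    simp only [gammaWeight, h]
  have h2 : mu γ w = mu γ' w := by
    funext α x y
    simp only [mu, h1]
  funext e
  revert e
  exact forall_edge fun x y hxy => by simp only [curvature_mk, pairCurvature, h2]

lemma flowField_congr {w : G.edgeSet → ℝ} (h : ∀ e, γ (w e) = γ' (w e)) :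
    flowField γ w = flowField γ' w := by
  funext e
  simp only [flowField, curvature_congr h]

/-- The curvature exists and is unique at positive weights, so the existential over `κ` disappears.
-/
lemma isRicciFlowOn_iff (hG : G.Connected) (hγ : ∀ x, 0 < x → 0 < γ x) :
    IsRicciFlowOn γ X₀ I X ↔ X 0 = X₀ ∧ (∀ t ∈ I, ∀ e, 0 < X t e) ∧
      ∀ t ∈ I, HasDerivWithinAt X (flowField γ (X t)) I t := by
  constructor
  · rintro ⟨h0, hpos, κ, hκ⟩
    refine ⟨h0, hpos, fun t ht => hasDerivWithinAt_pi.2 fun e => ?_⟩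
    have := (isCurvature_iff hG (hpos t ht) fun e => hγ _ (hpos t ht e)).1 (hκ t ht).1
    have hd := (hκ t ht).2 e
    rw [this] at hd
    exact hd
  · rintro ⟨h0, hpos, hd⟩
    refine ⟨h0, hpos, fun t => curvature γ (X t), fun t ht => ⟨?_, hasDerivWithinAt_pi.1 (hd t ht)⟩⟩
    exact (isCurvature_iff hG (hpos t ht) fun e => hγ _ (hpos t ht e)).2 rfl

lemma IsRicciFlowOn.mono (hX : IsRicciFlowOn γ X₀ J X) (hIJ : I ⊆ J) : IsRicciFlowOn γ X₀ I X := by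
  obtain ⟨h0, hpos, κ, hκ⟩ := hX
  exact ⟨h0, fun t ht => hpos t (hIJ ht), κ, fun t ht =>
    ⟨(hκ t (hIJ ht)).1, fun e => ((hκ t (hIJ ht)).2 e).mono hIJ⟩⟩

/-- With `u = ∑ w_e - 1` the flow gives `u' = u ∑ κ_h w_h`, and Grönwall forces `u = 0`. -/
lemma sum_eq_one_of_hasDerivWithinAt (hX : ContinuousOn X (Icc 0 T))
    (hd : ∀ t ∈ Ico 0 T, HasDerivWithinAt X (flowField γ (X t)) (Ici t) t)
    (h0 : ∑ e, X 0 e = 1) {C : ℝ} (hC : ∀ t ∈ Ico 0 T, |∑ h, curvature γ (X t) h * X t h| ≤ C) :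
    ∀ t ∈ Icc 0 T, ∑ e, X t e = 1 := by
  have hX' := continuousOn_pi.1 hX
  intro t ht
  have := eq_zero_of_abs_deriv_le_mul_abs_self_of_eq_zero_right
    (f := fun t => ∑ e, X t e - 1) (K := C)
    (f' := fun t => (∑ e, X t e - 1) * ∑ h, curvature γ (X t) h * X t h)
    ((continuousOn_finsetSum _ fun e _ => hX' e).sub continuousOn_const) ?_ (by simp [h0]) ?_ t ht
  · linarith
  · intro s hs
    have h1 := HasDerivWithinAt.fun_sum (u := Finset.univ) fun e _ =>
      hasDerivWithinAt_pi.1 (hd s hs) e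
    convert h1.sub_const 1 using 1
    simp only [flowField, Finset.sum_add_distrib, ← Finset.sum_mul, neg_mul,
      Finset.sum_neg_distrib]
    ring
  · intro s hs
    rw [norm_mul, mul_comm]
    exact mul_le_mul_of_nonneg_right (hC s hs) (norm_nonneg _)

lemma hasDerivWithinAt_Ici_of_Ico {E : Type*} [NormedAddCommGroup E] [NormedSpace ℝ E] {f : ℝ → E}
    {f' : E} {t : ℝ} (ht : t ∈ Ico 0 T) (h : HasDerivWithinAt f f' (Ico 0 T) t) :
    HasDerivWithinAt f f' (Ici t) t := by
  refine h.mono_of_mem_nhdsWithin (mem_of_superset (Ico_mem_nhdsGE ht.2) ?_)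
  exact Ico_subset_Ico_left ht.1

lemma IsRicciFlowOn.sum_eq_one (hG : G.Connected) (hγ : ∀ x, 0 < x → 0 < γ x)
    (h0 : ∑ e, X₀ e = 1) (hX : IsRicciFlowOn γ X₀ (Ico 0 T) X)
    (hexit : ∀ t ∈ Ico 0 T, ¬ ExitCondition (X t)) {t : ℝ} (ht : t ∈ Ico 0 T) :
    ∑ e, X t e = 1 := by
  obtain ⟨hinit, hpos, hd⟩ := (isRicciFlowOn_iff hG hγ).1 hX
  have hsub : Icc 0 t ⊆ Ico 0 T := fun s hs => ⟨hs.1, hs.2.trans_lt ht.2⟩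
  have hcont : ContinuousOn X (Icc 0 t) := fun s hs =>
    (hd s (hsub hs)).continuousWithinAt.mono hsub
  -- The bound `w_e ≤ 1` is only a consequence of this lemma; compactness of `[0, t]` supplies a
  -- provisional bound.
  obtain ⟨M, hM⟩ := isCompact_Icc.exists_bound_of_continuousOn hcont
  have hM0 : 0 ≤ M := (norm_nonneg _).trans (hM 0 ⟨le_rfl, ht.1⟩)
  have hXM : ∀ s ∈ Icc 0 t, ∀ e, X s e ≤ M := fun s hs e =>
    (le_abs_self _).trans ((norm_le_pi_norm (X s) e).trans (hM s hs))
  have hD := distBound_nonneg hG hM0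
  refine sum_eq_one_of_hasDerivWithinAt (γ := γ) hcont
    (fun s hs => hasDerivWithinAt_Ici_of_Ico (hsub (Ico_subset_Icc_self hs))
      (hd s (hsub (Ico_subset_Icc_self hs))))
    (by rw [hinit, h0]) (C := ∑ _e : G.edgeSet, (2 * M + 2 * distBound G M)) ?_ t ⟨ht.1, le_rfl⟩
  intro s hs
  have hs' := Ico_subset_Icc_self hs
  have hp := hpos s (hsub hs')
  refine (Finset.abs_sum_le_sum_abs _ _).trans (Finset.sum_le_sum fun e _ => abs_le.2 ⟨?_, ?_⟩)
  · have := neg_le_curvature_mul hG hp (fun e => hγ _ (hp e)) hM0 (hXM s hs') (hexit s (hsub hs')) e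
    linarith
  · have := curvature_le_two hG hp (fun e => hγ _ (hp e)) e
    have := hXM s hs' e
    nlinarith [hp e]

omit [Fintype V] in
lemma le_one_of_sum_eq_one {w : G.edgeSet → ℝ} (hw : ∀ e, 0 ≤ w e) (h : ∑ e, w e = 1)
    (e : G.edgeSet) : w e ≤ 1 :=
  h ▸ Finset.single_le_sum (fun e _ => hw e) (Finset.mem_univ e)

/-- The exponential rate at which edge weights can decay. -/
noncomputable def decayRate (G : SimpleGraph V) [Fintype G.edgeSet] : ℝ :=
  2 + ∑ _e : G.edgeSet, 2 * distBound G 1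

lemma decayRate_nonneg (hG : G.Connected) : 0 ≤ decayRate G := by
  have := distBound_nonneg hG zero_le_one
  unfold decayRate
  positivity

/-- The logarithmic derivative `-κ_e + ∑ κ_h w_h` is at least `-decayRate G`: the `2` in the rate
absorbs `κ_e`, the sum absorbs the rest. Hence `w_e exp (decayRate G * t)` is nondecreasing. -/
lemma IsRicciFlowOn.exp_le (hG : G.Connected) (hγ : ∀ x, 0 < x → 0 < γ x)
    (h0 : ∑ e, X₀ e = 1) (hX : IsRicciFlowOn γ X₀ (Ico 0 T) X)
    (hexit : ∀ t ∈ Ico 0 T, ¬ ExitCondition (X t)) {t : ℝ} (ht : t ∈ Ico 0 T) (e : G.edgeSet) :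
    X₀ e * Real.exp (-(decayRate G * t)) ≤ X t e := by
  obtain ⟨hinit, hpos, hd⟩ := (isRicciFlowOn_iff hG hγ).1 hX
  have hd' : ∀ s ∈ Ico 0 T, HasDerivWithinAt (fun s => X s e * Real.exp (decayRate G * s))
      (flowField γ (X s) e * Real.exp (decayRate G * s)
        + X s e * (Real.exp (decayRate G * s) * decayRate G)) (Ico 0 T) s := by
    intro s hs
    refine (hasDerivWithinAt_pi.1 (hd s hs) e).mul (HasDerivAt.hasDerivWithinAt ?_)
    simpa using ((hasDerivAt_id s).const_mul (decayRate G)).exp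
  have hmono : MonotoneOn (fun s => X s e * Real.exp (decayRate G * s)) (Ico 0 T) := by
    have hd'' : ∀ s ∈ interior (Ico 0 T), HasDerivAt (fun s => X s e * Real.exp (decayRate G * s))
        (flowField γ (X s) e * Real.exp (decayRate G * s)
          + X s e * (Real.exp (decayRate G * s) * decayRate G)) s := fun s hs =>
      (hd' s (interior_subset hs)).hasDerivAt (mem_interior_iff_mem_nhds.1 hs)
    refine monotoneOn_of_deriv_nonneg (convex_Ico 0 T)
      (fun s hs => (hd' s hs).continuousWithinAt)
      (fun s hs => (hd'' s hs).differentiableAt.differentiableWithinAt) fun s hs => ?_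
    rw [(hd'' s hs).deriv]
    have hs' := interior_subset hs
    have hp := hpos s hs'
    have h1 := curvature_le_two hG hp (fun e => hγ _ (hp e)) e
    have h2 : ∑ _h : G.edgeSet, -(2 * distBound G 1) ≤ ∑ h, curvature γ (X s) h * X s h :=
      Finset.sum_le_sum fun h _ => neg_le_curvature_mul hG hp (fun e => hγ _ (hp e)) zero_le_one
        (le_one_of_sum_eq_one (fun e => (hp e).le) (hX.sum_eq_one hG hγ h0 hexit hs'))
        (hexit s hs') h
    rw [Finset.sum_neg_distrib] at h2
    have h3 : flowField γ (X s) e * Real.exp (decayRate G * s)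
          + X s e * (Real.exp (decayRate G * s) * decayRate G) =
        X s e * Real.exp (decayRate G * s) * (-curvature γ (X s) e
          + ∑ h, curvature γ (X s) h * X s h + decayRate G) := by
      simp only [flowField]; ring
    rw [h3]
    refine mul_nonneg (mul_nonneg (hp e).le (Real.exp_pos _).le) ?_
    unfold decayRate
    linarith
  have h1 := hmono ⟨le_rfl, ht.1.trans_lt ht.2⟩ ht ht.1
  simp only [hinit, mul_zero, Real.exp_zero, mul_one] at h1
  rw [Real.exp_neg, ← div_eq_mul_inv]
  exact (div_le_iff₀ (Real.exp_pos _)).2 h1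

lemma IsRicciFlowOn.mem_weightBox (hG : G.Connected) (hγ : ∀ x, 0 < x → 0 < γ x)
    (h0 : ∑ e, X₀ e = 1) (hX₀ : ∀ e, 0 < X₀ e) (hX : IsRicciFlowOn γ X₀ (Ico 0 T) X)
    (hexit : ∀ t ∈ Ico 0 T, ¬ ExitCondition (X t))
    (hδ : ∀ e, δ ≤ X₀ e * Real.exp (-(decayRate G * T))) {t : ℝ} (ht : t ∈ Ico 0 T) :
    X t ∈ weightBox G δ 1 := by
  refine fun e => ⟨(hδ e).trans (le_trans ?_ (hX.exp_le hG hγ h0 hexit ht e)),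
    le_one_of_sum_eq_one (fun e => (hX.pos t ht e).le) (hX.sum_eq_one hG hγ h0 hexit ht) e⟩
  have := decayRate_nonneg hG
  have := (hX₀ e).le
  have := ht.2.le
  gcongr

lemma exists_le_mul_exp (h0 : ∑ e, X₀ e = 1) (hX₀ : ∀ e, 0 < X₀ e) (c : ℝ) :
    ∃ δ, 0 < δ ∧ ∀ e, δ ≤ X₀ e * Real.exp c := by
  have : Nonempty G.edgeSet := by
    by_contra h
    rw [not_nonempty_iff] at h
    simp at h0
  obtain ⟨e, he⟩ := Finite.exists_min X₀
  exact ⟨X₀ e * Real.exp c, mul_pos (hX₀ e) (Real.exp_pos _), fun e' =>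
    mul_le_mul_of_nonneg_right (he e') (Real.exp_pos _).le⟩

/-! ### The clamped field: uniqueness and existence on bounded intervals -/

lemma lipschitzOnWith_comp_min_one {K : NNReal} (hδ1 : δ ≤ 1) (hγ : LipschitzOnWith K γ (Icc δ 1)) :
    LipschitzOnWith K (fun x => γ (min x 1)) (Icc δ 2) := by
  refine LipschitzOnWith.of_dist_le_mul fun x hx y hy => ?_
  refine (hγ.dist_le_mul _ ⟨le_min hx.1 hδ1, min_le_right _ _⟩ _
    ⟨le_min hy.1 hδ1, min_le_right _ _⟩).trans ?_
  gcongr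
  exact abs_inf_sub_inf_le_abs x y 1

/-- A globally Lipschitz vector field that agrees with the normalized Ricci flow for edge weights in
`[δ, 1]`. -/
noncomputable def clampedField (γ : ℝ → ℝ) (δ : ℝ) (w : G.edgeSet → ℝ) : G.edgeSet → ℝ :=
  flowField (fun x => γ (min x 1)) (clampWeight δ 2 w)

lemma clampedField_of_mem {w : G.edgeSet → ℝ} (hw : w ∈ weightBox G δ 1) :
    clampedField γ δ w = flowField γ w := by
  rw [clampedField, clampWeight_of_mem fun e => ⟨(hw e).1, (hw e).2.trans one_le_two⟩]
  exact flowField_congr fun e => by rw [min_eq_left (hw e).2]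

lemma exists_clampedField_lipschitz (hG : G.Connected) (hγ : ∀ x, 0 < x → 0 < γ x)
    (hγ_lip : ∀ δ : ℝ, 0 < δ → ∃ K : NNReal, LipschitzOnWith K γ (Icc δ 1))
    (hδ : 0 < δ) (hδ1 : δ ≤ 1) :
    (∃ C, LipschitzWith C (clampedField (G := G) γ δ)) ∧
      ∃ L : NNReal, ∀ w : G.edgeSet → ℝ, ‖clampedField γ δ w‖ ≤ L := by
  obtain ⟨K, hK⟩ := hγ_lip δ hδ
  exact exists_flowField_clampWeight_lipschitz hG hδ (hδ1.trans one_le_two)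
    (lipschitzOnWith_comp_min_one hδ1 hK)
    fun x hx => hγ _ (lt_min (hδ.trans_le hx.1) one_pos)

/-- The a priori box depends only on `X₀` and `T`, so both solutions are trajectories of the same
globally Lipschitz field. -/
lemma IsRicciFlowOn.eqOn (hG : G.Connected) (hγ : ∀ x, 0 < x → 0 < γ x)
    (hγ_lip : ∀ δ : ℝ, 0 < δ → ∃ K : NNReal, LipschitzOnWith K γ (Icc δ 1))
    (h0 : ∑ e, X₀ e = 1) (hX₀ : ∀ e, 0 < X₀ e)
    (hX : IsRicciFlowOn γ X₀ (Ico 0 T) X) (hX_exit : ∀ t ∈ Ico 0 T, ¬ ExitCondition (X t))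
    (hY : IsRicciFlowOn γ X₀ (Ico 0 T) Y) (hY_exit : ∀ t ∈ Ico 0 T, ¬ ExitCondition (Y t)) :
    EqOn X Y (Ico 0 T) := by
  intro t ht
  obtain ⟨δ, hδ, hδX⟩ := exists_le_mul_exp h0 hX₀ (-(decayRate G * T))
  have hδX' : ∀ e, min δ 1 ≤ X₀ e * Real.exp (-(decayRate G * T)) := fun e =>
    (min_le_left _ _).trans (hδX e)
  obtain ⟨⟨C, hC⟩, -⟩ := exists_clampedField_lipschitz hG hγ hγ_lip (lt_min hδ one_pos)
    (min_le_right _ _)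
  have hsub : Icc 0 t ⊆ Ico 0 T := fun s hs => ⟨hs.1, hs.2.trans_lt ht.2⟩
  have key : ∀ {Z : ℝ → G.edgeSet → ℝ}, IsRicciFlowOn γ X₀ (Ico 0 T) Z →
      (∀ t ∈ Ico 0 T, ¬ ExitCondition (Z t)) → Z 0 = X₀ ∧ ContinuousOn Z (Icc 0 t) ∧
        ∀ s ∈ Ico 0 t, HasDerivWithinAt Z (clampedField γ (min δ 1) (Z s)) (Ici s) s := by
    intro Z hZ hexit
    obtain ⟨hinit, -, hd⟩ := (isRicciFlowOn_iff hG hγ).1 hZ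
    refine ⟨hinit, fun s hs => (hd s (hsub hs)).continuousWithinAt.mono hsub, fun s hs => ?_⟩
    have hs' := hsub (Ico_subset_Icc_self hs)
    rw [clampedField_of_mem (hZ.mem_weightBox hG hγ h0 hX₀ hexit hδX' hs')]
    exact hasDerivWithinAt_Ici_of_Ico hs' (hd s hs')
  obtain ⟨hX0, hXc, hXd⟩ := key hX hX_exit
  obtain ⟨hY0, hYc, hYd⟩ := key hY hY_exit
  exact ODE_solution_unique (v := fun _ => clampedField γ (min δ 1)) (fun _ => hC) hXc hXd hYc hYd
    (hX0.trans hY0.symm) ⟨ht.1, le_rfl⟩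

omit [Fintype V] [Fintype G.edgeSet] in
lemma isClosed_weightBox (δ M : ℝ) : IsClosed (weightBox G δ M) := by
  simp only [weightBox, ofPred_forall]
  exact isClosed_iInter fun e => isClosed_Icc.preimage (continuous_apply e)

/-- A trajectory of the clamped field that stays in the box solves the normalized Ricci flow. -/
lemma isRicciFlowOn_of_clampedField (hG : G.Connected) (hγ : ∀ x, 0 < x → 0 < γ x)
    (hγ_lip : ∀ δ : ℝ, 0 < δ → ∃ K : NNReal, LipschitzOnWith K γ (Icc δ 1))
    (h0 : ∑ e, X₀ e = 1) (hδ : 0 < δ) (hδ1 : δ ≤ 1) (hinit : X 0 = X₀)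
    (hd : ∀ t ∈ Icc 0 T, HasDerivWithinAt X (clampedField γ δ (X t)) (Icc 0 T) t)
    (hbox : ∀ t ∈ Ico 0 T, X t ∈ weightBox G δ 2) : IsRicciFlowOn γ X₀ (Ico 0 T) X := by
  obtain ⟨K, hK⟩ := hγ_lip δ hδ
  obtain ⟨-, C, -, hC⟩ := isBddLip_sum_curvature_mul (G := G) hG hδ (hδ1.trans one_le_two)
    (lipschitzOnWith_comp_min_one hδ1 hK) fun x hx => hγ _ (lt_min (hδ.trans_le hx.1) one_pos)
  have hpos : ∀ t ∈ Ico 0 T, ∀ e, 0 < X t e := fun t ht e => hδ.trans_le (hbox t ht e).1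
  have hd' : ∀ t ∈ Ico 0 T, HasDerivWithinAt X (clampedField γ δ (X t)) (Ico 0 T) t := fun t ht =>
    (hd t (Ico_subset_Icc_self ht)).mono Ico_subset_Icc_self
  -- In `[δ, 2]` the clamp is inactive but `γ` is still truncated at `1`. Conservation of the total
  -- weight holds for the truncated `γ` too; it forces weights at most `1`, where the truncation has
  -- no effect.
  have hsum := sum_eq_one_of_hasDerivWithinAt (fun t ht => (hd t ht).continuousWithinAt)
    (γ := fun x => γ (min x 1))
    (fun t ht => by
      have := hasDerivWithinAt_Ici_of_Ico ht (hd' t ht)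
      rwa [clampedField, clampWeight_of_mem (hbox t ht)] at this)
    (by rw [hinit, h0]) fun t ht => hC _ (hbox t ht)
  refine (isRicciFlowOn_iff hG hγ).2 ⟨hinit, hpos, fun t ht => ?_⟩
  rw [← clampedField_of_mem (δ := δ) fun e => ⟨(hbox t ht e).1, le_one_of_sum_eq_one
    (fun e => (hpos t ht e).le) (hsum t (Ico_subset_Icc_self ht)) e⟩]
  exact hd' t ht

lemma exists_isRicciFlowOn_Ico (hG : G.Connected) (hγ : ∀ x, 0 < x → 0 < γ x)
    (hγ_lip : ∀ δ : ℝ, 0 < δ → ∃ K : NNReal, LipschitzOnWith K γ (Icc δ 1))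
    (h0 : ∑ e, X₀ e = 1) (hX₀ : ∀ e, 0 < X₀ e)
    (hexit : ∀ (T : ℝ) (X : ℝ → G.edgeSet → ℝ), 0 < T → IsRicciFlowOn γ X₀ (Ico 0 T) X →
      ∀ t ∈ Ico 0 T, ¬ ExitCondition (X t)) (hT : 0 < T) :
    ∃ X, IsRicciFlowOn γ X₀ (Ico 0 T) X := by
  obtain ⟨η, hη, hηX⟩ := exists_le_mul_exp h0 hX₀ (-(decayRate G * T))
  -- With `δ < η` and `1 < 2` the a priori box `[η, 1]` lies in the interior of the clamping box
  -- `[δ, 2]`.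
  obtain ⟨δ, hδ, hδη, hδ1⟩ : ∃ δ, 0 < δ ∧ δ < η ∧ δ ≤ 1 :=
    ⟨min (η / 2) 1, lt_min (by linarith) one_pos, (min_le_left _ _).trans_lt (by linarith),
      min_le_right _ _⟩
  obtain ⟨⟨C, hC⟩, L, hL⟩ := exists_clampedField_lipschitz (G := G) hG hγ hγ_lip hδ hδ1
  -- A field bounded by `L` moves a point by at most `L T`, so this radius allows the whole interval
  -- at once.
  have hPL : IsPicardLindelof (fun _ => clampedField γ δ) (⟨0, le_rfl, hT.le⟩ : Icc 0 T) X₀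
      (L * T.toNNReal) 0 L C := by
    refine .of_time_independent (fun x _ => hL x) hC.lipschitzOnWith ?_
    simp [hT.le]
  obtain ⟨X, hinit, hd⟩ := hPL.exists_eq_forall_mem_Icc_hasDerivWithinAt₀
  replace hinit : X 0 = X₀ := hinit
  have hcont : ContinuousOn X (Icc 0 T) := fun t ht => (hd t ht).continuousWithinAt
  set U : Set (G.edgeSet → ℝ) := {w | ∀ e, w e ∈ Ioo δ 2} with hU
  have hUo : IsOpen U := by
    simp only [hU, ofPred_forall]
    exact isOpen_iInter_of_finite fun e => isOpen_Ioo.preimage (continuous_apply e)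
  have hUbox : ∀ w ∈ U, w ∈ weightBox G δ 2 := fun w hw e => Ioo_subset_Icc_self (hw e)
  have hstay : ∀ t ∈ Icc 0 T, X t ∈ U := by
    by_contra! hne
    have hS : IsCompact (Icc 0 T ∩ X ⁻¹' Uᶜ) :=
      isCompact_Icc.of_isClosed_subset
        (hcont.preimage_isClosed_of_isClosed isClosed_Icc hUo.isClosed_compl) inter_subset_left
    -- `τ` is the first time outside `U`. Before `τ` the curve is a genuine flow, so the a priori
    -- bounds hold on `[0, τ)` and pass to `τ` by closure; they put `X τ` back in `U`.
    obtain ⟨τ, ⟨hτT, hτU⟩, hmin⟩ := hS.exists_isLeast hne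
    have hsub : Icc 0 τ ⊆ Icc 0 T := Icc_subset_Icc_right hτT.2
    have hbefore : ∀ t ∈ Ico 0 τ, X t ∈ U := fun t ht => by
      by_contra h
      exact (hmin ⟨hsub (Ico_subset_Icc_self ht), h⟩).not_gt ht.2
    have hflow := isRicciFlowOn_of_clampedField hG hγ hγ_lip h0 hδ hδ1 hinit
      (fun t ht => (hd t (hsub ht)).mono hsub) fun t ht => hUbox _ (hbefore t ht)
    have hX₀η : ∀ e, η ≤ X₀ e * Real.exp (-(decayRate G * τ)) := fun e => by
      refine (hηX e).trans ?_
      have := decayRate_nonneg hG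
      have := (hX₀ e).le
      have := hτT.2
      gcongr
    refine hτU ?_
    suffices X τ ∈ weightBox G η 1 from
      fun e => ⟨hδη.trans_le (this e).1, (this e).2.trans_lt one_lt_two⟩
    rcases hτT.1.eq_or_lt with h | h
    · rw [← h] at hX₀η ⊢
      simp only [mul_zero, neg_zero, Real.exp_zero, mul_one] at hX₀η
      intro e
      rw [hinit]
      exact ⟨hX₀η e, le_one_of_sum_eq_one (fun e => (hX₀ e).le) h0 e⟩
    · have hmaps : MapsTo X (Ico 0 τ) (weightBox G η 1) := fun t ht =>
        hflow.mem_weightBox hG hγ h0 hX₀ (hexit τ X h hflow) hX₀η ht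
      have := hmaps.closure_of_continuousOn (by rw [closure_Ico h.ne]; exact hcont.mono hsub)
      rw [closure_Ico h.ne, (isClosed_weightBox η 1).closure_eq] at this
      exact this ⟨h.le, le_rfl⟩
  exact ⟨X, isRicciFlowOn_of_clampedField hG hγ hγ_lip h0 hδ hδ1 hinit hd fun t ht =>
    hUbox _ (hstay t (Ico_subset_Icc_self ht))⟩

end Flow

end RicciFlow

/-! ### Gluing to a solution for all times -/

theorem theorem3p1 {V : Type*} [Fintype V] (G : SimpleGraph V) [Fintype G.edgeSet]
    (hG : G.Connected)
    (γ : ℝ → ℝ) (hγ_pos : ∀ x, 0 < x → 0 < γ x)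
    (hγ_lip : ∀ δ : ℝ, 0 < δ → ∃ K : NNReal, LipschitzOnWith K γ (Set.Icc δ 1))
    (X₀ : G.edgeSet → ℝ) (hX₀_pos : ∀ e, 0 < X₀ e) (hX₀_sum : ∑ e, X₀ e = 1)
    (hexit : ∀ (T : ℝ) (X : ℝ → G.edgeSet → ℝ), 0 < T →
      RicciFlow.IsRicciFlowOn γ X₀ (Set.Ico 0 T) X →
      ∀ t ∈ Set.Ico 0 T, ¬ RicciFlow.ExitCondition (X t)) :
    ∃ X : ℝ → G.edgeSet → ℝ, RicciFlow.IsRicciFlowOn γ X₀ (Set.Ici 0) X ∧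
      ∀ Y : ℝ → G.edgeSet → ℝ, RicciFlow.IsRicciFlowOn γ X₀ (Set.Ici 0) Y →
        Set.EqOn Y X (Set.Ici 0) := by
  have huniq : ∀ {T : ℝ} {X Y : ℝ → G.edgeSet → ℝ}, 0 < T →
      RicciFlow.IsRicciFlowOn γ X₀ (Ico 0 T) X → RicciFlow.IsRicciFlowOn γ X₀ (Ico 0 T) Y →
        EqOn X Y (Ico 0 T) := fun hT hX hY =>
    hX.eqOn hG hγ_pos hγ_lip hX₀_sum hX₀_pos (hexit _ _ hT hX) hY (hexit _ _ hT hY)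
  choose Z hZ using fun n : ℕ => RicciFlow.exists_isRicciFlowOn_Ico hG hγ_pos hγ_lip hX₀_sum
    hX₀_pos hexit (T := (n : ℝ) + 1) (by positivity)
  -- `Z n` lives on `[0, n + 1)`, so `Z ⌊t⌋₊` is defined past `t`; by uniqueness the glued curve is
  -- `Z n` on all of `[0, n + 1)`, which transfers derivatives even at integer times.
  have hglue : ∀ n : ℕ, ∀ t ∈ Ico (0 : ℝ) (n + 1), Z ⌊t⌋₊ t = Z n t := by
    intro n t ht
    have hle : ((⌊t⌋₊ : ℕ) : ℝ) ≤ n := by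
      exact_mod_cast Nat.lt_succ_iff.1 ((Nat.floor_lt ht.1).2 (by exact_mod_cast ht.2))
    exact huniq (by positivity) (hZ _) ((hZ n).mono (Ico_subset_Ico_right (by linarith)))
      ⟨ht.1, Nat.lt_floor_add_one t⟩
  have hX : RicciFlow.IsRicciFlowOn γ X₀ (Ici 0) fun t => Z ⌊t⌋₊ t := by
    refine (RicciFlow.isRicciFlowOn_iff hG hγ_pos).2 ⟨by simpa using (hZ 0).init,
      fun t ht => (hZ _).pos t ⟨ht, Nat.lt_floor_add_one t⟩, fun t ht => ?_⟩
    have hmem : t ∈ Ico (0 : ℝ) (⌊t⌋₊ + 1) := ⟨ht, Nat.lt_floor_add_one t⟩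
    have hd := ((RicciFlow.isRicciFlowOn_iff hG hγ_pos).1 (hZ ⌊t⌋₊)).2.2 t hmem
    refine (hd.congr (hglue ⌊t⌋₊) rfl).mono_of_mem_nhdsWithin ?_
    rw [← Ici_inter_Iio]
    exact inter_mem self_mem_nhdsWithin (mem_nhdsWithin_of_mem_nhds (Iio_mem_nhds hmem.2))
  refine ⟨_, hX, fun Y hY t ht => ?_⟩
  have hsub : Ico 0 (t + 1) ⊆ Ici (0 : ℝ) := fun s hs => hs.1
  have ht' : (0 : ℝ) ≤ t := ht
  exact huniq (by positivity) (hY.mono hsub) (hX.mono hsub) ⟨ht, by linarith⟩
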